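/- Let $\mathbf{T_2Unif}$ be the category of $T_2$ (Hausdorff) uniform spaces and uniformly continuous maps. Subcategories are understood to be full and closed under isomorphism, and are identified with their classes of objects. A subcategory is epireflective if it is reflective and all reflection morphisms are epimorphisms of $\mathbf{T_2Unif}$. A bimorphism is a morphism that is both a monomorphism and an epimorphism; in $\mathbf{T_2Unif}$ the epimorphisms are the dense maps, the bimorphisms the dense injections, the extremal monomorphisms the closed embeddings, and the extremal epimorphisms the quotient maps. A subcategory $\mathcal C$ is closed under $\mathbf E$-images (for a class $\mathbf E$ of epimorphisms) if $C\in\mathcal C$, $e\in\mathbf E$, $e\colon C\to D$ imply $D\in\mathcal C$, and closed under extremal subobjects if $C\in\mathcal C$ and the existence of an extremal monomorphism $D\to C$ imply $D\in\mathcal C$. The covering character of a uniform space $X$ is the smallest infinite cardinal $\lambda$ such that $X$ has a base of uniform coverings of cardinalities less than $\lambda$. Theorem. Let $\mathcal C$ be a subcategory of $\mathbf{T_2Unif}$. The following are equivalent: 1) $\mathcal C$ is an epireflective subcategory of $\mathbf{T_2Unif}$, closed under epi images. 2) Either $\mathcal C=\{X\in\mathbf{T_2Unif} : |X|\le 1\}$,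 or $\mathcal C=\{X\in\mathbf{T_2Unif} : X \text{ is compact}\}$, or there is an infinite cardinal $\lambda_0$ such that $\mathcal C=\{X\in\mathbf{T_2Unif} : X \text{ has covering character at most } \lambda_0\}$, or $\mathcal C=\mathbf{T_2Unif}$. Moreover, 1) is equivalent to: $\mathcal C$ is closed under products, extremal subobjects, bimorphic images and extremal epi images. None of these four closure properties can be omitted without invalidating the implication $1)\Rightarrow 2)$: for each of the four there is a subcategory of $\mathbf{T_2Unif}$ that has the other three properties but is not one of the subcategories in 2). -/

import Mathlib

open CategoryTheory Cardinal Uniformity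

universe v u w

/-! ### Categorical notions -/

namespace CategoryTheory

/-- A monomorphism `m` is extremal if in every factorization `m = e ≫ g` with `e` an epimorphism,
`e` is an isomorphism (dual to `CategoryTheory.ExtremalEpi`). -/
structure IsExtremalMono {D : Type w} [Category.{v} D] {X Y : D} (m : X ⟶ Y) : Prop where
  mono : Mono m
  isIso : ∀ {Z : D} (e : X ⟶ Z) (g : Z ⟶ Y), e ≫ g = m → Epi e → IsIso e

/-- The class of extremal monomorphisms. -/
def MorphismProperty.extremalMonos (D : Type w) [Category.{v} D] : MorphismProperty D :=
  fun _ _ m => IsExtremalMono m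

/-- The class of extremal epimorphisms. -/
def MorphismProperty.extremalEpis (D : Type w) [Category.{v} D] : MorphismProperty D :=
  fun _ _ e => ExtremalEpi e

/-- The class of bimorphisms: morphisms that are both mono and epi. -/
def MorphismProperty.bimorphisms (D : Type w) [Category.{v} D] : MorphismProperty D :=
  fun _ _ f => Mono f ∧ Epi f

/-- The full subcategory on `P` is epireflective: it is reflective, and all the reflection
morphisms `X ⟶ L X` are epimorphisms of the ambient category. -/
def ObjectProperty.IsEpireflective {D : Type w} [Category.{v} D] (P : ObjectProperty D) : Prop :=
  ∃ r : Reflective P.ι, ∀ X : D, Epi (r.adj.unit.app X)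

/-- `P` is closed under all (set-indexed, possibly empty) categorical products. -/
def ObjectProperty.IsClosedUnderProducts {D : Type w} [Category.{v} D] (P : ObjectProperty D) :
    Prop :=
  ∀ J : Type v, P.IsClosedUnderLimitsOfShape (Discrete J)

end CategoryTheory

/-! ### Uniform coverings and the covering character -/

/-- A family `𝒰` of subsets of `X` is a uniform covering if for some entourage `V` every ball
`{y | (x, y) ∈ V}` is contained in a member of `𝒰`. -/
def IsUniformCovering (X : Type u) [UniformSpace X] (𝒰 : Set (Set X)) : Prop :=
  ∃ V ∈ 𝓤 X, ∀ x : X, ∃ U ∈ 𝒰, UniformSpace.ball x V ⊆ U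

/-- `ℬ` is a base of uniform coverings: it consists of uniform coverings, and each uniform
covering is refined by a member of `ℬ`. -/
def IsBaseOfUniformCoverings (X : Type u) [UniformSpace X] (ℬ : Set (Set (Set X))) : Prop :=
  (∀ 𝒱 ∈ ℬ, IsUniformCovering X 𝒱) ∧
    ∀ 𝒰, IsUniformCovering X 𝒰 → ∃ 𝒱 ∈ ℬ, ∀ V ∈ 𝒱, ∃ U ∈ 𝒰, V ⊆ U

/-- The infinite cardinals `l` such that `X` has a base of uniform coverings of cardinalities
less than `l`. -/
def coveringCardinals (X : Type u) [UniformSpace X] : Set Cardinal.{u} :=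
  {l | ℵ₀ ≤ l ∧ ∃ ℬ, IsBaseOfUniformCoverings X ℬ ∧ ∀ 𝒱 ∈ ℬ, #𝒱 < l}

/-- The covering character: the smallest infinite cardinal `l` such that `X` has a base of uniform
coverings of cardinalities less than `l`. -/
noncomputable def coveringCharacter (X : Type u) [UniformSpace X] : Cardinal.{u} :=
  sInf (coveringCardinals X)

/-- The infimum that defines the covering character is attained. -/
theorem coveringCharacter_mem (X : Type u) [UniformSpace X] :
    coveringCharacter X ∈ coveringCardinals X := by
  refine csInf_mem ⟨max ℵ₀ (Order.succ #(Set X)), le_max_left _ _,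
    {𝒰 | IsUniformCovering X 𝒰}, ⟨fun _ h => h, fun 𝒰 h => ⟨𝒰, h, fun V hV => ⟨V, hV, le_rfl⟩⟩⟩,
    fun 𝒱 _ => ?_⟩
  exact lt_max_of_lt_right (Order.lt_succ_of_le (mk_set_le 𝒱))

/-! ### The category of Hausdorff uniform spaces -/

/-- The category of `T₂` uniform spaces and uniformly continuous maps. -/
abbrev T2Unif : Type (u + 1) :=
  ObjectProperty.FullSubcategory (fun X : UniformSpaceCat.{u} => T2Space X)

namespace T2Unif

/-- The spaces with at most one point. -/
def atMostOnePoint : ObjectProperty T2Unif.{u} := fun X => Subsingleton X.obj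

/-- The compact spaces. -/
def compactSpaces : ObjectProperty T2Unif.{u} := fun X => CompactSpace X.obj

/-- The spaces of covering character at most `l`. -/
def coveringCharacterLE (l : Cardinal.{u}) : ObjectProperty T2Unif.{u} :=
  fun X => coveringCharacter X.obj ≤ l

/-- The subcategory `C` is one of the four kinds: at most one point, compact, covering character
at most some infinite cardinal, everything. -/
def IsOfFourKinds (C : ObjectProperty T2Unif.{u}) : Prop :=
  C = atMostOnePoint ∨ C = compactSpaces ∨
    (∃ l : Cardinal.{u}, ℵ₀ ≤ l ∧ C = coveringCharacterLE l) ∨ C = ⊤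

end T2Unif

/-!
The equivalence of the first condition with the four closure properties rests on two
identifications in `T2Unif`. Epimorphisms are the dense maps: if the closure `A` of the range of
`f : X ⟶ Y` is not everything, the maps `y ↦ {y} ∪ A` and `y ↦ A` into the hyperspace of closed
sets of `Y` agree on the range of `f` but differ (`epi_iff`). Every morphism is an extremal
epimorphism followed by a monomorphism (`exists_extremalEpi_mono`), so that closure under epi
images is closure under bimorphic and extremal epi images. All four properties together therefore
say that `C` is closed under product spaces, closed subspaces and dense images
(`ClosureProperties`). Such a `C` is epireflective, as the dense images of a space in `C` have a
set of representatives (`ClosureProperties.isEpireflective`).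

For the classification (`ClosureProperties.isOfFourKinds`), let `C` have these closure properties
and a member with two points. Three facts determine `C`.
* Let all discrete spaces with fewer than `l` points be in `C`. If each entourage `V` of `X` has a
  partition of `X` into fewer than `l` sets that are `V`-small, then the completion of `X` is in
  `C`. Indeed, these partitions map `X` to a product of discrete spaces, and the closure of the
  image maps onto a dense subset of the completion (`ClosureProperties.of_partitionFilter_le`).
  Since finite discrete spaces are in `C`, it follows that all compact spaces are.
* If `C` has a member `W` that is not complete, it contains every space of which it contains the
  completion (`ClosureProperties.of_completion`). Such a `W` exists as soon as `C` has a member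
  that is not compact (`ClosureProperties.exists_not_completeSpace`).
* Conversely, each entourage of a space in `C` has a partition into small sets that is indexed by
  a discrete space in `C` (`ClosureProperties.exists_discrete_partition`).

Thus if not all members of `C` are compact, then either `C` contains all discrete spaces, and
hence everything, or the least cardinality `l` of a discrete space outside `C` is infinite and `C`
consists of the spaces whose entourages have partitions as above, that is, of those with covering
character at most `l` (`coveringCharacter_le_iff`).

The four properties are independent, as is shown by the spaces with at most two points, the
connected spaces, the spaces in which each countable set is contained in a compact set, and the
compact totally disconnected spaces.
-/

open Limits TopologicalSpace Set

namespace T2Unif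

/-! ### Morphisms of Hausdorff uniform spaces -/

/-- The object of `T2Unif` given by a Hausdorff uniform space. -/
abbrev of (α : Type u) [UniformSpace α] [T2Space α] : T2Unif.{u} := ⟨UniformSpaceCat.of α, ‹_›⟩

instance (X : T2Unif.{u}) : T2Space X.obj := X.property

/-- The morphism given by a uniformly continuous map. -/
def homMk {X Y : T2Unif.{u}} (f : X.obj → Y.obj) (hf : UniformContinuous f) : X ⟶ Y :=
  ObjectProperty.homMk ⟨⟨f, hf⟩⟩

/-- The map underlying a morphism. -/
def fn {X Y : T2Unif.{u}} (f : X ⟶ Y) : X.obj → Y.obj := f.hom.hom'.1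

variable {X Y : T2Unif.{u}}

lemma uniformContinuous_fn (f : X ⟶ Y) : UniformContinuous (fn f) := f.hom.hom'.2

lemma fn_ext {f g : X ⟶ Y} (h : ∀ x, fn f x = fn g x) : f = g :=
  ObjectProperty.hom_ext _ (UniformSpaceCat.hom_ext (funext h))

/-- Inverse uniformly continuous maps are the two directions of an isomorphism. -/
def isoMk (f : X.obj → Y.obj) (hf : UniformContinuous f) (g : Y.obj → X.obj)
    (hg : UniformContinuous g) (hgf : ∀ x, g (f x) = x) (hfg : ∀ y, f (g y) = y) : X ≅ Y where
  hom := homMk f hf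
  inv := homMk g hg
  hom_inv_id := fn_ext hgf
  inv_hom_id := fn_ext hfg

lemma mono_iff (f : X ⟶ Y) : Mono f ↔ Function.Injective (fn f) := by
  constructor
  · intro _ x y hxy
    have h : (homMk (X := of PUnit) (fun _ => x) uniformContinuous_const : of PUnit ⟶ X) =
        homMk (fun _ => y) uniformContinuous_const := by
      rw [← cancel_mono f]
      exact fn_ext fun _ => hxy
    exact congrArg (fun k => fn k PUnit.unit) h
  · exact fun hf => ⟨fun g h e => fn_ext fun x => hf (congrArg (fun k => fn k x) e)⟩

/-- If the range of `f` is not dense, its closure `A` is distinguished from the whole space by the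
maps `y ↦ {y} ∪ A` and `y ↦ A` into the hyperspace of closed sets. -/
lemma epi_iff (f : X ⟶ Y) : Epi f ↔ DenseRange (fn f) := by
  constructor
  · intro _ y
    let A : Closeds Y.obj := .closure (range (fn f))
    have hu : UniformContinuous fun y : Y.obj => ({y} ⊔ A : Closeds Y.obj) :=
      Closeds.uniformContinuous_singleton.sup_closeds uniformContinuous_const
    have h : (homMk (Y := of (Closeds Y.obj)) _ hu : Y ⟶ of (Closeds Y.obj)) =
        homMk (fun _ => A) uniformContinuous_const := by
      rw [← cancel_epi f]
      refine fn_ext fun x => sup_eq_right.2 ?_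
      rintro _ rfl
      exact subset_closure (mem_range_self x)
    have h' : ({y} ⊔ A : Closeds Y.obj) = A := congrArg (fun k => fn k y) h
    have : y ∈ ({y} ⊔ A : Closeds Y.obj) := Or.inl rfl
    rw [h'] at this
    exact this
  · refine fun hf => ⟨fun {Z} g h e => fn_ext fun y => ?_⟩
    have := hf.equalizer (uniformContinuous_fn g).continuous (uniformContinuous_fn h).continuous
      (funext fun x => congrArg (fun k => fn k x) e)
    exact congrFun this y

/-! ### Factorizations of morphisms -/

/-- The corestriction of a morphism to a set containing its range. -/
def codRestrict (f : X ⟶ Y) (s : Set Y.obj) (h : ∀ x, fn f x ∈ s) : X ⟶ of s :=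
  homMk (fun x => ⟨fn f x, h x⟩) ((uniformContinuous_fn f).subtype_mk h)

/-- The inclusion of a subspace. -/
def incl (s : Set Y.obj) : of s ⟶ Y := homMk Subtype.val uniformContinuous_subtype_val

lemma codRestrict_incl (f : X ⟶ Y) (s : Set Y.obj) (h : ∀ x, fn f x ∈ s) :
    codRestrict f s h ≫ incl s = f := rfl

instance (s : Set Y.obj) : Mono (incl s) := (mono_iff _).2 Subtype.val_injective

instance epi_codRestrict_closure (f : X ⟶ Y) :
    Epi (codRestrict f (closure (range (fn f))) fun x => subset_closure (mem_range_self x)) := by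
  rw [epi_iff]
  rintro ⟨y, hy⟩
  rw [closure_subtype, ← range_comp]
  exact hy

lemma isExtremalMono_incl {s : Set Y.obj} (hs : IsClosed s) : IsExtremalMono (incl s) where
  mono := inferInstance
  isIso {Z} e g h he := by
    rw [epi_iff] at he
    have hval : ∀ x, fn g (fn e x) = x.1 := fun x => congrArg (fun k => fn k x) h
    have hg : ∀ z, fn g z ∈ s := fun z =>
      (hs.preimage (uniformContinuous_fn g).continuous).closure_subset_iff.2
        (by rintro _ ⟨x, rfl⟩; simp [hval]) (he z)
    have hid : codRestrict g s hg ≫ e = 𝟙 Z := by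
      have : Epi e := (epi_iff e).2 he
      rw [← cancel_epi e]
      exact fn_ext fun x => congrArg (fn e) (Subtype.ext (hval x))
    exact ⟨codRestrict g s hg, fn_ext fun x => Subtype.ext (hval x), hid⟩

lemma surjective_of_extremalEpi (f : X ⟶ Y) [ExtremalEpi f] : Function.Surjective (fn f) := by
  have := ExtremalEpi.isIso f _ _ (codRestrict_incl f (range (fn f)) mem_range_self)
  intro y
  obtain ⟨x, hx⟩ := (fn (inv (incl (range (fn f)))) y).2
  exact ⟨x, hx.trans (congrArg (fun k => fn k y) (IsIso.inv_hom_id (incl (range (fn f)))))⟩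

/-- Every morphism is an extremal epimorphism followed by a monomorphism: the intermediate object
is the set-theoretic range with the finest uniformity for which the corestriction is uniformly
continuous. -/
lemma exists_extremalEpi_mono (f : X ⟶ Y) :
    ∃ (Z : T2Unif.{u}) (e : X ⟶ Z) (m : Z ⟶ Y), ExtremalEpi e ∧ Mono m ∧ e ≫ m = f := by
  obtain ⟨S, r, j, hr, hj, hjr⟩ : ∃ (S : Type u) (r : X.obj → S) (j : S → Y.obj),
      Function.Surjective r ∧ Function.Injective j ∧ j ∘ r = fn f :=
    ⟨range (fn f), rangeFactorization (fn f), Subtype.val, rangeFactorization_surjective,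
      Subtype.val_injective, rfl⟩
  let U : UniformSpace S := sInf {u | @UniformContinuous _ _ _ u r}
  have hUle {u : UniformSpace S} (hu : @UniformContinuous _ _ _ u r) : U ≤ u := sInf_le hu
  have hjU : UniformContinuous j := by
    rw [uniformContinuous_iff_le_comap]
    refine hUle (uniformContinuous_comap' ?_)
    rw [hjr]
    exact uniformContinuous_fn f
  have hrU : UniformContinuous r := by
    rw [uniformContinuous_sInf_rng]
    exact fun u hu => hu
  have hU2 : T2Space S := .of_injective_continuous hj hjU.continuous
  let e : X ⟶ of S := homMk r hrU
  refine ⟨of S, e, homMk j hjU, ?_, (mono_iff _).2 hj, fn_ext fun x => congrFun hjr x⟩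
  have : Epi e := (epi_iff e).2 hr.denseRange
  refine ⟨fun {W} p i hpi _ => ?_⟩
  have hpi' : ∀ x, fn i (fn p x) = r x := fun x => congrArg (fun k => fn k x) hpi
  have hi : Function.Bijective (fn i) :=
    ⟨(mono_iff i).1 inferInstance, fun z => by
      obtain ⟨x, rfl⟩ := hr z
      exact ⟨_, hpi' x⟩⟩
  let E := Equiv.ofBijective _ hi
  have hsymm : UniformContinuous E.symm := by
    rw [uniformContinuous_iff_le_comap]
    refine hUle (uniformContinuous_comap' ?_)
    convert uniformContinuous_fn p using 1
    exact funext fun x => E.symm_apply_eq.2 (hpi' x).symm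
  exact (isoMk (fn i) (uniformContinuous_fn i) E.symm hsymm E.symm_apply_apply
    E.apply_symm_apply).isIso_hom

end T2Unif

namespace CategoryTheory.ObjectProperty

variable {D : Type w} [Category.{v} D] {P : ObjectProperty D}

/-- An object whose epi reflection map is split mono is isomorphic to its reflection. -/
lemma prop_of_unit_comp_eq_id [P.IsClosedUnderIsomorphisms] (r : Reflective P.ι)
    (h : ∀ X : D, Epi (r.adj.unit.app X)) {X : D} (g : (r.L.obj X).obj ⟶ X)
    (hg : r.adj.unit.app X ≫ g = 𝟙 X) : P X := by
  have := h X
  have hg' : g ≫ r.adj.unit.app X = 𝟙 _ := by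
    rw [← cancel_epi (r.adj.unit.app X), reassoc_of% hg]
    exact (Category.comp_id _).symm
  exact P.prop_of_iso ⟨g, r.adj.unit.app X, hg', hg⟩ (r.L.obj X).property

/-- Morphisms into an object of a reflective subcategory factor through the reflection. -/
lemma exists_unit_comp_eq (r : Reflective P.ι) {X Y : D} (hY : P Y) (f : X ⟶ Y) :
    ∃ g : (r.L.obj X).obj ⟶ Y, r.adj.unit.app X ≫ g = f :=
  ⟨((r.adj.homEquiv X ⟨Y, hY⟩).symm f).hom, (r.adj.homEquiv X ⟨Y, hY⟩).apply_symm_apply f⟩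

lemma IsEpireflective.isClosedUnderProducts [P.IsClosedUnderIsomorphisms]
    (h : P.IsEpireflective) : P.IsClosedUnderProducts := by
  obtain ⟨r, hr⟩ := h
  refine fun J => ⟨fun X ⟨p⟩ => ?_⟩
  choose g hg using fun j => exists_unit_comp_eq r (p.prop_diag_obj j) (p.π.app j)
  let c : Cone p.diag := ⟨(r.L.obj X).obj, Discrete.natTrans g⟩
  refine prop_of_unit_comp_eq_id r hr (p.isLimit.lift c) ?_
  refine p.isLimit.hom_ext fun j => ?_
  rw [Category.assoc, p.isLimit.fac]
  exact (hg j).trans (Category.id_comp _).symm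

lemma IsEpireflective.inheritedFromTarget_extremalMonos [P.IsClosedUnderIsomorphisms]
    (h : P.IsEpireflective) : P.InheritedFromTarget (MorphismProperty.extremalMonos D) := by
  obtain ⟨r, hr⟩ := h
  refine ⟨fun {X Y} m hm hY => ?_⟩
  obtain ⟨g, hg⟩ := exists_unit_comp_eq r hY m
  have := hm.isIso _ g hg (hr X)
  exact P.prop_of_iso (asIso (r.adj.unit.app X)).symm (r.L.obj X).property

/-- A subcategory is epireflective as soon as every object has an epimorphism to an object of the
subcategory that is weakly universal. -/
lemma isEpireflective_of_exists (h : ∀ X : D, ∃ (Y : D) (η : X ⟶ Y), P Y ∧ Epi η ∧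
    ∀ (Z : D) (_ : P Z) (f : X ⟶ Z), ∃ g : Y ⟶ Z, η ≫ g = f) : P.IsEpireflective := by
  choose R η hR hη hu using h
  choose lift hlift using hu
  let e (X : D) (Y : P.FullSubcategory) :
      ((⟨R X, hR X⟩ : P.FullSubcategory) ⟶ Y) ≃ (X ⟶ P.ι.obj Y) :=
    { toFun := fun g => η X ≫ g.hom
      invFun := fun f => ObjectProperty.homMk (lift X Y.obj Y.property f)
      left_inv := fun g => by
        ext
        rw [← cancel_epi (η X)]
        exact hlift _ _ _ _
      right_inv := fun f => hlift _ _ _ _ }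
  have he (X : D) (Y Y' : P.FullSubcategory) (g : Y ⟶ Y')
      (h : (⟨R X, hR X⟩ : P.FullSubcategory) ⟶ Y) : e X Y' (h ≫ g) = e X Y h ≫ P.ι.map g :=
    (Category.assoc _ _ _).symm
  refine ⟨{ L := _, adj := Adjunction.adjunctionOfEquivLeft e he }, fun X => ?_⟩
  have : (Adjunction.adjunctionOfEquivLeft e he).unit.app X = η X := by
    simp [e]
  exact this ▸ hη X

end CategoryTheory.ObjectProperty

namespace T2Unif

/-! ### The closure properties in terms of spaces -/

/-- The cone over a discrete diagram of Hausdorff uniform spaces given by the product space. -/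
def piCone {J : Type u} (F : Discrete J ⥤ T2Unif.{u}) : Cone F where
  pt := of (∀ j : J, (F.obj ⟨j⟩).obj)
  π := Discrete.natTrans fun j =>
    homMk (fun x => x j.as) (Pi.uniformContinuous_proj _ j.as)

/-- The product space is a categorical product. -/
def isLimitPiCone {J : Type u} (F : Discrete J ⥤ T2Unif.{u}) : IsLimit (piCone F) where
  lift s := homMk (fun x j => fn (s.π.app ⟨j⟩) x)
    (uniformContinuous_pi.2 fun j => uniformContinuous_fn (s.π.app ⟨j⟩))
  fac _ _ := rfl
  uniq _ _ hm := fn_ext fun x => funext fun j => congrArg (fun k => fn k x) (hm ⟨j⟩)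

/-- Closure under product spaces, closed subspaces and images under uniformly continuous maps with
dense range. -/
structure ClosureProperties (C : ObjectProperty T2Unif.{u}) : Prop where
  pi : ∀ {J : Type u} (α : J → Type u) [∀ j, UniformSpace (α j)] [∀ j, T2Space (α j)],
    (∀ j, C (of (α j))) → C (of (∀ j, α j))
  subtype : ∀ {α : Type u} [UniformSpace α] [T2Space α] {s : Set α}, IsClosed s →
    C (of α) → C (of s)
  denseRange : ∀ {α β : Type u} [UniformSpace α] [T2Space α] [UniformSpace β] [T2Space β]
    {f : α → β}, UniformContinuous f → DenseRange f → C (of α) → C (of β)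

variable {C : ObjectProperty T2Unif.{u}}

lemma isClosedUnderProducts_iff [C.IsClosedUnderIsomorphisms] : C.IsClosedUnderProducts ↔
    ∀ {J : Type u} (α : J → Type u) [∀ j, UniformSpace (α j)] [∀ j, T2Space (α j)],
      (∀ j, C (of (α j))) → C (of (∀ j, α j)) := by
  constructor
  · intro h J α _ _ hα
    have := h J
    exact C.prop_of_isLimit (isLimitPiCone (Discrete.functor fun j => of (α j)))
      fun j => hα j.as
  · refine fun h J => ⟨fun X ⟨p⟩ => ?_⟩
    exact C.prop_of_iso ((isLimitPiCone p.diag).conePointUniqueUpToIso p.isLimit)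
      (h (fun j => (p.diag.obj ⟨j⟩).obj) fun j => p.prop_diag_obj ⟨j⟩)

lemma inheritedFromTarget_extremalMonos_iff [C.IsClosedUnderIsomorphisms] :
    C.InheritedFromTarget (MorphismProperty.extremalMonos T2Unif.{u}) ↔
    ∀ {α : Type u} [UniformSpace α] [T2Space α] {s : Set α}, IsClosed s →
      C (of α) → C (of s) := by
  constructor
  · exact fun h α _ _ s hs hα => h.of_hom_of_target (incl (Y := of α) s) (isExtremalMono_incl hs) hα
  · refine fun h => ⟨fun {X Y} m hm hY => ?_⟩
    let e : X ⟶ of (closure (range (fn m))) :=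
      codRestrict m _ fun x => subset_closure (mem_range_self x)
    have : IsIso e := hm.isIso e (incl _) rfl inferInstance
    exact C.prop_of_iso (asIso e).symm (h isClosed_closure hY)

lemma inheritedFromSource_epimorphisms_iff :
    C.InheritedFromSource (MorphismProperty.epimorphisms T2Unif.{u}) ↔
    ∀ {α β : Type u} [UniformSpace α] [T2Space α] [UniformSpace β] [T2Space β]
      {f : α → β}, UniformContinuous f → DenseRange f → C (of α) → C (of β) := by
  constructor
  · exact fun h α β _ _ _ _ f hf hd hα =>
      h.of_hom_of_source (homMk (X := of α) (Y := of β) f hf) ((epi_iff _).2 hd) hα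
  · exact fun h => ⟨fun f hf hX => h (uniformContinuous_fn f) ((epi_iff f).1 hf) hX⟩

lemma inheritedFromSource_bimorphisms_of
    (h : ∀ {α β : Type u} [UniformSpace α] [T2Space α] [UniformSpace β] [T2Space β]
      {f : α → β}, UniformContinuous f → DenseRange f → Function.Injective f →
      C (of α) → C (of β)) :
    C.InheritedFromSource (MorphismProperty.bimorphisms T2Unif.{u}) :=
  ⟨fun f hf hX => h (uniformContinuous_fn f) ((epi_iff f).1 hf.2) ((mono_iff f).1 hf.1) hX⟩

lemma inheritedFromSource_extremalEpis_of
    (h : ∀ {α β : Type u} [UniformSpace α] [T2Space α] [UniformSpace β] [T2Space β]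
      {f : α → β}, UniformContinuous f → Function.Surjective f → C (of α) → C (of β)) :
    C.InheritedFromSource (MorphismProperty.extremalEpis T2Unif.{u}) :=
  ⟨fun f (_ : ExtremalEpi f) hX => h (uniformContinuous_fn f) (surjective_of_extremalEpi f) hX⟩

/-- Every epimorphism is an extremal epimorphism followed by a bimorphism. -/
lemma inheritedFromSource_epimorphisms_iff_bimorphisms_and_extremalEpis :
    C.InheritedFromSource (MorphismProperty.epimorphisms T2Unif.{u}) ↔
      C.InheritedFromSource (MorphismProperty.bimorphisms T2Unif.{u}) ∧
        C.InheritedFromSource (MorphismProperty.extremalEpis T2Unif.{u}) := by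
  constructor
  · exact fun h => ⟨⟨fun f hf => h.of_hom_of_source f hf.2⟩,
      ⟨fun f (hf : ExtremalEpi f) => h.of_hom_of_source f hf.toEpi⟩⟩
  · rintro ⟨hb, he⟩
    refine ⟨fun f (hf : Epi f) hX => ?_⟩
    obtain ⟨Z, e, m, hee, hm, rfl⟩ := exists_extremalEpi_mono f
    exact hb.of_hom_of_source m ⟨hm, epi_of_epi e m⟩ (he.of_hom_of_source e hee hX)

lemma closureProperties_iff [C.IsClosedUnderIsomorphisms] : ClosureProperties C ↔
    C.IsClosedUnderProducts ∧
      C.InheritedFromTarget (MorphismProperty.extremalMonos T2Unif.{u}) ∧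
      C.InheritedFromSource (MorphismProperty.bimorphisms T2Unif.{u}) ∧
      C.InheritedFromSource (MorphismProperty.extremalEpis T2Unif.{u}) := by
  rw [← inheritedFromSource_epimorphisms_iff_bimorphisms_and_extremalEpis,
    isClosedUnderProducts_iff, inheritedFromTarget_extremalMonos_iff,
    inheritedFromSource_epimorphisms_iff]
  exact ⟨fun h => ⟨h.pi, h.subtype, h.denseRange⟩, fun h => ⟨h.1, h.2.1, h.2.2⟩⟩

/-! ### Epireflections -/

/-- A point `y` in the target of a dense map into a Hausdorff space is recovered from the trace of
its neighborhood filter on the source. -/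
lemma injective_comap_nhds {α β : Type*} [TopologicalSpace β] [T2Space β] {f : α → β}
    (hf : DenseRange f) : Function.Injective fun y => (Filter.comap f (nhds y)).sets := by
  intro y z (h : (Filter.comap f (nhds y)).sets = (Filter.comap f (nhds z)).sets)
  have hne : (Filter.comap f (nhds y)).NeBot :=
    Filter.comap_neBot_iff.2 fun t ht => (hf.inter_nhds_nonempty ht).elim fun _ ha =>
      ha.1.elim fun x hx => ⟨x, hx ▸ ha.2⟩
  by_contra hyz
  have hd := Filter.disjoint_comap (m := f) (disjoint_nhds_nhds.2 hyz)
  rw [← Filter.filter_eq h, disjoint_self] at hd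
  exact hne.ne hd

/-- A uniformly continuous map from `X` to a space in `C` whose points are families of subsets
of `X`. By `injective_comap_nhds`, each dense image of `X` in `C` is isomorphic to one of these, and
all of them together form a type in the universe of `X`. -/
structure ImageOnSets (C : ObjectProperty T2Unif.{u}) (X : T2Unif.{u}) : Type u where
  carrier : Set (Set (Set X.obj))
  [uniformSpace : UniformSpace carrier]
  [t2Space : T2Space carrier]
  prop : C (of carrier)
  toFun : X.obj → carrier
  uniformContinuous : UniformContinuous toFun

attribute [instance] ImageOnSets.uniformSpace ImageOnSets.t2Space

/-- A map `f` from `X` to a space in `C` factors through some member of `ImageOnSets C X`. -/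
lemma ClosureProperties.exists_imageOnSets (h : ClosureProperties C) {X Z : T2Unif.{u}} (hZ : C Z)
    (f : X ⟶ Z) :
    ∃ (j : ImageOnSets C X) (g : of j.carrier ⟶ Z), ∀ x, fn g (j.toFun x) = fn f x := by
  let B := closure (range (fn f))
  let f' : X ⟶ of B := codRestrict f B fun x => subset_closure (mem_range_self x)
  let E : B ≃ range fun b : B => (Filter.comap (fn f') (nhds b)).sets :=
    Equiv.ofInjective _ (injective_comap_nhds ((epi_iff f').1 inferInstance))
  let _ : UniformSpace (range fun b : B => (Filter.comap (fn f') (nhds b)).sets) :=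
    .comap E.symm inferInstance
  have hsymm : UniformContinuous E.symm := uniformContinuous_comap
  have hE : UniformContinuous E := uniformContinuous_comap' (by simpa using uniformContinuous_id)
  have : T2Space (range fun b : B => (Filter.comap (fn f') (nhds b)).sets) :=
    .of_injective_continuous E.symm.injective hsymm.continuous
  refine ⟨⟨_, h.denseRange hE E.surjective.denseRange (h.subtype isClosed_closure hZ),
    fun x => E (fn f' x), hE.comp (uniformContinuous_fn f')⟩,
    homMk (fun b => (E.symm b).1) (uniformContinuous_subtype_val.comp hsymm), fun x => ?_⟩
  exact congrArg Subtype.val (E.symm_apply_apply (fn f' x))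

/-- The reflection of `X` is the closure of the diagonal image of `X` in the product of the spaces
in `ImageOnSets C X`. -/
lemma ClosureProperties.isEpireflective (h : ClosureProperties C) : C.IsEpireflective := by
  refine ObjectProperty.isEpireflective_of_exists fun X => ?_
  let p : X ⟶ of (∀ j : ImageOnSets C X, j.carrier) := homMk (fun x j => j.toFun x)
    (uniformContinuous_pi.2 fun j => j.uniformContinuous)
  refine ⟨of (closure (range (fn p))),
    codRestrict p _ fun x => subset_closure (mem_range_self x),
    h.subtype isClosed_closure (h.pi _ fun j => j.prop), epi_codRestrict_closure p,
    fun Z hZ f => ?_⟩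
  obtain ⟨j, g, hg⟩ := h.exists_imageOnSets hZ f
  exact ⟨incl _ ≫ homMk (Y := of j.carrier) (fun x => x j) (Pi.uniformContinuous_proj _ j) ≫ g,
    fn_ext hg⟩

/-- Epireflectivity together with closure under epi images amounts to the closure properties. -/
lemma isEpireflective_and_inheritedFromSource_iff [C.IsClosedUnderIsomorphisms] :
    C.IsEpireflective ∧ C.InheritedFromSource (MorphismProperty.epimorphisms T2Unif.{u}) ↔
      ClosureProperties C :=
  ⟨fun h => ⟨isClosedUnderProducts_iff.1 h.1.isClosedUnderProducts,
    inheritedFromTarget_extremalMonos_iff.1 h.1.inheritedFromTarget_extremalMonos,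
    inheritedFromSource_epimorphisms_iff.1 h.2⟩,
    fun h => ⟨h.isEpireflective, inheritedFromSource_epimorphisms_iff.2 h.denseRange⟩⟩

/-! ### Covering character and partitions -/

/-- The relations `V` on `X` for which `X` has a partition into fewer than `l` sets (given as
the fibers of a map `f`) such that `V` relates any two points of the same set. As `l` is infinite,
these relations form a filter. -/
def partitionFilter {l : Cardinal.{u}} (hl : ℵ₀ ≤ l) (X : Type u) : Filter (X × X) where
  sets := {V | ∃ (ι : Type u) (f : X → ι), #ι < l ∧ ∀ x y, f x = f y → (x, y) ∈ V}
  univ_sets := ⟨PUnit, fun _ => PUnit.unit, by simpa using one_lt_aleph0.trans_le hl,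
    fun _ _ _ => trivial⟩
  sets_of_superset := fun ⟨ι, f, hι, hf⟩ hVW => ⟨ι, f, hι, fun x y h => hVW (hf x y h)⟩
  inter_sets := fun ⟨ι, f, hι, hf⟩ ⟨κ, g, hκ, hg⟩ =>
    ⟨ι × κ, fun x => (f x, g x), by simpa using mul_lt_of_lt hl hι hκ,
      fun x y h => ⟨hf x y (Prod.ext_iff.1 h).1, hg x y (Prod.ext_iff.1 h).2⟩⟩

variable {l : Cardinal.{u}} {hl : ℵ₀ ≤ l}

lemma mem_partitionFilter {X : Type u} {V : Set (X × X)} : V ∈ partitionFilter hl X ↔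
    ∃ (ι : Type u) (f : X → ι), #ι < l ∧ ∀ x y, f x = f y → (x, y) ∈ V := Iff.rfl

lemma tendsto_partitionFilter {X Y : Type u} (g : X → Y) :
    Filter.Tendsto (Prod.map g g) (partitionFilter hl X) (partitionFilter hl Y) :=
  fun _ ⟨ι, f, hι, hf⟩ => ⟨ι, f ∘ g, hι, fun _ _ h => hf _ _ h⟩

/-- The covering character of `X` is at most `l` if each entourage `V` has a partition of `X` into
fewer than `l` sets that are `V`-small. -/
lemma coveringCharacter_le_iff (hl : ℵ₀ ≤ l) {X : Type u} [UniformSpace X] :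
    coveringCharacter X ≤ l ↔ partitionFilter hl X ≤ 𝓤 X := by
  constructor
  · intro h V hV
    obtain ⟨W, hW, hWs, hWV⟩ := comp_symm_mem_uniformity_sets hV
    obtain ⟨-, ℬ, ⟨hℬ, hℬ'⟩, hℬl⟩ := coveringCharacter_mem X
    obtain ⟨𝒱, h𝒱, hr⟩ := hℬ' (range fun x => UniformSpace.ball x W)
      ⟨W, hW, fun x => ⟨_, mem_range_self x, Subset.rfl⟩⟩
    obtain ⟨V', hV', hc⟩ := hℬ 𝒱 h𝒱
    choose U hU hxU using hc
    refine ⟨𝒱, fun x => ⟨U x, hU x⟩, (hℬl 𝒱 h𝒱).trans_le h, fun x y hxy => ?_⟩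
    obtain ⟨_, ⟨z, rfl⟩, hz⟩ := hr (U x) (hU x)
    have hx : x ∈ UniformSpace.ball z W := hz (hxU x (refl_mem_uniformity hV'))
    have hUxy : U x = U y := Subtype.ext_iff.1 hxy
    have hy : y ∈ UniformSpace.ball z W := hz (hUxy ▸ hxU y (refl_mem_uniformity hV'))
    exact hWV ⟨z, hWs.symm _ _ hx, hy⟩
  · intro h
    refine csInf_le' ⟨hl, {𝒰 | IsUniformCovering X 𝒰 ∧ #𝒰 < l}, ⟨fun _ h => h.1, ?_⟩,
      fun _ h => h.2⟩
    rintro 𝒰 ⟨V, hV, hV𝒰⟩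
    obtain ⟨W, hW, hWs, hWV⟩ := comp_symm_mem_uniformity_sets hV
    obtain ⟨ι, f, hι, hf⟩ := h hW
    let g (i : ι) : Set X := {y | ∃ x, f x = i ∧ (x, y) ∈ W}
    refine ⟨range (g ∘ f), ⟨⟨W, hW, fun x => ⟨_, mem_range_self x, fun y hy => ⟨x, rfl, hy⟩⟩⟩,
      ((mk_le_mk_of_subset (range_comp_subset_range f g)).trans mk_range_le).trans_lt hι⟩, ?_⟩
    rintro _ ⟨x, rfl⟩
    obtain ⟨U, hU, hxU⟩ := hV𝒰 x
    refine ⟨U, hU, fun y ⟨x', hx', hy⟩ => hxU (hWV ⟨x', hf _ _ hx'.symm, hy⟩)⟩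

lemma partitionFilter_aleph0_le_iff {X : Type u} [UniformSpace X] :
    partitionFilter le_rfl X ≤ 𝓤 X ↔ TotallyBounded (univ : Set X) := by
  constructor
  · intro h V hV
    obtain ⟨ι, f, hι, hf⟩ := h (symm_le_uniformity hV)
    have : Finite ι := lt_aleph0_iff_finite.1 hι
    have hr : Function.Surjective (rangeFactorization f) := rangeFactorization_surjective
    let g := Function.surjInv hr
    refine ⟨range g, finite_range g, fun x _ => mem_iUnion₂.2 ⟨_, mem_range_self
      (rangeFactorization f x), hf (g (rangeFactorization f x)) x ?_⟩⟩
    exact congrArg Subtype.val (Function.surjInv_eq hr (rangeFactorization f x))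
  · intro h V hV
    obtain ⟨W, hW, hWs, hWV⟩ := comp_symm_mem_uniformity_sets hV
    obtain ⟨t, ht, hc⟩ := h W hW
    simp only [univ_subset_iff, eq_univ_iff_forall, mem_iUnion₂] at hc
    choose f hft hf using hc
    have := ht.to_subtype
    refine ⟨t, fun x => ⟨f x, hft x⟩, lt_aleph0_iff_finite.2 this, fun x y h => ?_⟩
    have hxy : f x = f y := Subtype.ext_iff.1 h
    exact hWV ⟨f x, hf x, hxy ▸ hWs.symm _ _ (hf y)⟩

/-! ### The four kinds have the closure properties -/

lemma closureProperties_atMostOnePoint : ClosureProperties atMostOnePoint.{u} where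
  pi α _ _ h := by
    have : ∀ j, Subsingleton (α j) := h
    exact inferInstanceAs (Subsingleton (∀ j, α j))
  subtype {α} _ _ s _ h := by
    have : Subsingleton α := h
    exact inferInstanceAs (Subsingleton s)
  denseRange {α β} _ _ _ _ f _ hd h := by
    have : Subsingleton α := h
    have := (subsingleton_range f).closure
    rw [hd.closure_range] at this
    exact subsingleton_univ_iff.1 this

lemma closureProperties_compactSpaces : ClosureProperties compactSpaces.{u} where
  pi α _ _ h := by
    have : ∀ j, CompactSpace (α j) := h
    exact inferInstanceAs (CompactSpace (∀ j, α j))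
  subtype {α} _ _ s hs h := by
    have : CompactSpace α := h
    exact isCompact_iff_compactSpace.1 hs.isCompact
  denseRange {α β} _ _ _ _ f hf hd h := by
    have : CompactSpace α := h
    have hc := isCompact_range hf.continuous
    refine ⟨?_⟩
    rwa [hc.isClosed.closure_eq.symm.trans hd.closure_range] at hc

lemma closureProperties_coveringCharacterLE (hl : ℵ₀ ≤ l) :
    ClosureProperties (coveringCharacterLE l) where
  pi α _ _ h := by
    refine (coveringCharacter_le_iff hl).2 ?_
    change _ ≤ 𝓤 (∀ j, α j)
    rw [Pi.uniformity]
    exact le_iInf fun j => Filter.map_le_iff_le_comap.1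
      ((tendsto_partitionFilter fun x : ∀ j, α j => x j).mono_right
        ((coveringCharacter_le_iff hl).1 (h j)))
  subtype {α} _ _ s _ h := by
    refine (coveringCharacter_le_iff hl).2 ?_
    change _ ≤ 𝓤 s
    rw [uniformity_subtype]
    exact Filter.map_le_iff_le_comap.1 ((tendsto_partitionFilter Subtype.val).mono_right
        ((coveringCharacter_le_iff hl).1 h))
  denseRange {α β} _ _ _ _ f hf hd h := by
    refine (coveringCharacter_le_iff hl).2 fun V hV => ?_
    obtain ⟨W, hW, hWs, hWV⟩ := comp_comp_symm_mem_uniformity_sets hV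
    obtain ⟨ι, c, hι, hc⟩ := (coveringCharacter_le_iff hl).1 h (hf hW)
    have hy (y : β) : ∃ x, (y, f x) ∈ W := by
      obtain ⟨_, hx, x, rfl⟩ := UniformSpace.mem_closure_iff_ball.1 (hd y) hW
      exact ⟨x, hx⟩
    choose g hg using hy
    exact ⟨ι, c ∘ g, hι, fun y z h => hWV
      ⟨f (g z), ⟨f (g y), hg y, hc _ _ h⟩, hWs.symm _ _ (hg z)⟩⟩

lemma IsOfFourKinds.closureProperties {C : ObjectProperty T2Unif.{u}} (h : IsOfFourKinds C) :
    ClosureProperties C := by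
  rcases h with rfl | rfl | ⟨l, hl, rfl⟩ | rfl
  · exact closureProperties_atMostOnePoint
  · exact closureProperties_compactSpaces
  · exact closureProperties_coveringCharacterLE hl
  · exact ⟨fun _ _ _ _ => trivial, fun _ _ => trivial, fun _ _ _ => trivial⟩

/-! ### Discrete spaces in a subcategory with the closure properties -/

/-- The set `ι` with the discrete uniformity. -/
abbrev discrete (ι : Type u) : T2Unif.{u} :=
  letI : UniformSpace ι := ⊥
  of ι

lemma discrete_eq_of (ι : Type u) [u : UniformSpace ι] [T2Space ι] [DiscreteUniformity ι] :
    discrete ι = of ι := by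
  obtain rfl : u = ⊥ := DiscreteUniformity.eq_bot
  rfl

namespace ClosureProperties

lemma prod (h : ClosureProperties C) {α β : Type u} [UniformSpace α] [T2Space α] [UniformSpace β]
    [T2Space β] (hα : C (of α)) (hβ : C (of β)) : C (of (α × β)) := by
  let P (b : ULift.{u} Bool) : T2Unif.{u} := cond b.down (of α) (of β)
  have hP : C (of (∀ b, (P b).obj)) := h.pi _ (by rintro ⟨_ | _⟩; exacts [hβ, hα])
  let f (x : ∀ b, (P b).obj) : α × β := (x ⟨true⟩, x ⟨false⟩)
  have hf : UniformContinuous f :=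
    (Pi.uniformContinuous_proj (fun b => (P b).obj) ⟨true⟩).prodMk
      (Pi.uniformContinuous_proj (fun b => (P b).obj) ⟨false⟩)
  refine h.denseRange hf (Function.Surjective.denseRange fun ⟨a, b⟩ => ?_) hP
  exact ⟨fun | ⟨true⟩ => a | ⟨false⟩ => b, rfl⟩

/-- A discrete space in `C` has all spaces of at most its cardinality as images of subspaces. -/
lemma of_discrete (h : ClosureProperties C) {ι α : Type u} [UniformSpace α] [T2Space α]
    (hι : C (discrete ι)) (hα : #α ≤ #ι) : C (of α) := by
  let _ : UniformSpace ι := ⊥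
  obtain ⟨e⟩ := hα
  have : DiscreteUniformity (range e) := isUniformEmbedding_subtype_val.discreteUniformity
  exact h.denseRange (DiscreteUniformity.uniformContinuous _ (Equiv.ofInjective e e.injective).symm)
    (Equiv.surjective _).denseRange (h.subtype (isClosed_discrete (range e)) hι)

lemma of_subsingleton (h : ClosureProperties C) {α : Type u} [UniformSpace α] [T2Space α]
    [Subsingleton α] : C (of α) := by
  let _ : UniformSpace PUnit.{u + 1} := ⊥
  have hp : C (of (∀ _ : PEmpty.{u + 1}, PUnit.{u + 1})) := h.pi _ (by rintro ⟨⟩)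
  have hpt : C (discrete PUnit.{u + 1}) := h.denseRange (f := fun _ => PUnit.unit)
    uniformContinuous_const (Function.Surjective.denseRange fun _ => ⟨nofun, rfl⟩) hp
  exact h.of_discrete hpt (by simpa using le_one_iff_subsingleton.2 ‹Subsingleton α›)

/-- A space in `C` with two points provides all finite spaces: they are closed subspaces of powers
of the two-point space. -/
lemma of_finite (h : ClosureProperties C) {X : T2Unif.{u}} (hX : C X) [Nontrivial X.obj]
    (ι : Type u) [Finite ι] : C (discrete ι) := by
  classical
  obtain ⟨x, y, hxy⟩ := exists_pair_ne X.obj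
  let f (i : ι) : ι → X.obj := fun j => if i = j then x else y
  have hf : Function.Injective f := fun i j hij => by
    by_contra hne
    have := congrFun hij i
    simp only [f, if_pos rfl, if_neg (Ne.symm hne)] at this
    exact hxy this
  let _ : UniformSpace ι := ⊥
  exact h.denseRange (DiscreteUniformity.uniformContinuous _ (Equiv.ofInjective f hf).symm)
    (Equiv.surjective _).denseRange (h.subtype (finite_range f).isClosed (h.pi _ fun _ => hX))

/-- For each entourage `V`, a space in `C` has a `V`-small partition indexed by a discrete space
in `C`, since a maximal uniformly separated set is a closed discrete subspace. -/
lemma exists_discrete_partition (h : ClosureProperties C) {X : T2Unif.{u}} (hX : C X)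
    {V : Set (X.obj × X.obj)} (hV : V ∈ 𝓤 X.obj) :
    ∃ (ι : Type u) (f : X.obj → ι), C (discrete ι) ∧ ∀ x y, f x = f y → (x, y) ∈ V := by
  obtain ⟨W, hW, hWs, hWV⟩ := comp_symm_mem_uniformity_sets hV
  obtain ⟨S, hS⟩ := zorn_subset {S : Set X.obj | S.Pairwise fun x y => (x, y) ∉ W}
    fun c hc hchain => ⟨⋃₀ c, (pairwise_sUnion hchain.directedOn).2 fun s hs => hc hs,
      fun s hs => subset_sUnion_of_mem hs⟩
  have hcov (x : X.obj) : ∃ s : S, (s.1, x) ∈ W := by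
    by_contra! hx
    have hins : insert x S ∈ {S : Set X.obj | S.Pairwise fun x y => (x, y) ∉ W} :=
      hS.1.insert fun s hs _ => ⟨fun hm => hx ⟨s, hs⟩ (hWs.symm _ _ hm), hx ⟨s, hs⟩⟩
    exact hx ⟨x, hS.2 hins (subset_insert x S) (mem_insert x S)⟩ (refl_mem_uniformity hW)
  choose f hf using hcov
  have hSd : DiscreteUniformity S := by
    rw [discreteUniformity_iff_setRelId_mem_uniformity, uniformity_subtype]
    refine ⟨W, hW, fun ⟨s, t⟩ hst => ?_⟩
    by_contra hne
    exact hS.1 s.2 t.2 (fun e => hne (Subtype.ext e)) hst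
  refine ⟨S, f, ?_, fun x y hxy => hWV ⟨f x, hWs.symm _ _ (hf x), hxy ▸ hf y⟩⟩
  rw [discrete_eq_of]
  exact h.subtype (isClosed_of_spaced_out hW hS.1) hX

/-! ### Completeness -/

/-- Suppose all discrete spaces with fewer than `l` points are in `C`. If each entourage `V` of `X`
has a `V`-small partition indexed by a set `ι V` with fewer than `l` elements, then these
partitions map `X` to the product of the discrete spaces `ι V`. Each uniformly continuous map from
`X` to a complete space extends to the closure of the image of `X`. -/
lemma of_partitionFilter_le (h : ClosureProperties C) {l : Cardinal.{u}} (hl : ℵ₀ ≤ l)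
    (hlC : ∀ ι : Type u, #ι < l → C (discrete ι)) {X Y : Type u} [UniformSpace X]
    (hX : partitionFilter hl X ≤ 𝓤 X) [UniformSpace Y] [T2Space Y] [CompleteSpace Y]
    {g : X → Y} (hg : UniformContinuous g) (hgd : DenseRange g) : C (of Y) := by
  have hex (V : {V // V ∈ 𝓤 X}) := hX V.2
  choose ι f hι hf using hex
  let _ (V : {V // V ∈ 𝓤 X}) : UniformSpace (ι V) := ⊥
  let p (x : X) : ∀ V, ι V := fun V => f V x
  let F := closure (range p)
  have hF : C (of F) := h.subtype isClosed_closure (h.pi ι fun V => hlC _ (hι V))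
  let e (x : X) : F := ⟨p x, subset_closure (mem_range_self x)⟩
  have hed : DenseRange e := fun y => by
    rw [closure_subtype, ← range_comp]
    exact y.2
  -- The uniformity that the partitions induce on `X` is finer than the given one.
  have hle : UniformSpace.comap e inferInstance ≤ (inferInstance : UniformSpace X) := by
    intro V hV
    have : {q : (∀ V, ι V) × ∀ V, ι V | q.1 ⟨V, hV⟩ = q.2 ⟨V, hV⟩} ∈ 𝓤 (∀ V, ι V) :=
      Pi.uniformContinuous_proj ι ⟨V, hV⟩
        (DiscreteUniformity.relId_mem_uniformity (ι ⟨V, hV⟩))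
    refine Filter.mem_comap.2 ⟨_, uniformContinuous_subtype_val this, ?_⟩
    rintro ⟨x, y⟩ hxy
    exact hf ⟨V, hV⟩ x y hxy
  let _ : UniformSpace X := UniformSpace.comap e inferInstance
  have hei : IsUniformInducing e := ⟨rfl⟩
  have hg' : UniformContinuous g := hg.mono_left hle
  refine h.denseRange (uniformContinuous_uniformly_extend hei hed hg') ?_ hF
  refine hgd.mono ?_
  rintro _ ⟨x, rfl⟩
  exact ⟨e x, uniformly_extend_of_ind hei hed hg' x⟩

/-- If `C` has a member `W` that is not complete, it contains `X` along with the completion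
of `X`: take a point `z` of the completion of `W` outside `W`. Among the pairs of points of the two
completions, those that have first coordinate different from `z` or second coordinate in `X` form a
space that has `W × X` as a dense subspace and `{z} × X` as a closed subspace. -/
lemma of_completion (h : ClosureProperties C) {W : Type u} [UniformSpace W] [T2Space W]
    (hW : C (of W)) (hWc : ¬ CompleteSpace W) {X : Type u} [UniformSpace X] [T2Space X]
    (hX : C (of (UniformSpace.Completion X))) : C (of X) := by
  open UniformSpace.Completion in
  have hz : ∃ z : UniformSpace.Completion W, ∀ w : W, (w : UniformSpace.Completion W) ≠ z := by
    by_contra! hs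
    exact hWc (((isUniformInducing_coe W).completeSpace_congr hs).2 inferInstance)
  obtain ⟨z, hz⟩ := hz
  let T : Set (UniformSpace.Completion W × UniformSpace.Completion X) :=
    {t | t.1 = z → t.2 ∈ range ((↑) : X → UniformSpace.Completion X)}
  let f (p : W × UniformSpace.Completion X) : T := ⟨(p.1, p.2), fun hp => (hz _ hp).elim⟩
  have hf : UniformContinuous f :=
    (((uniformContinuous_coe W).comp uniformContinuous_fst).prodMk
      uniformContinuous_snd).subtype_mk _
  have hfd : DenseRange f := by
    intro t
    rw [closure_subtype, ← range_comp]
    exact (denseRange_coe.prodMap denseRange_id) t.1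
  have hT : C (of T) := h.denseRange hf hfd (h.prod hW hX)
  let A : Set T := {t | t.1.1 = z}
  have hA : C (of A) := h.subtype
    (isClosed_eq (continuous_fst.comp continuous_subtype_val) continuous_const) hT
  choose g hg using fun a : A => a.1.2 a.2
  have hgu : UniformContinuous g := by
    rw [(isUniformInducing_coe X).uniformContinuous_iff]
    have : ((↑) : X → UniformSpace.Completion X) ∘ g = fun a => a.1.1.2 := funext hg
    rw [this]
    exact uniformContinuous_snd.comp
      (uniformContinuous_subtype_val.comp uniformContinuous_subtype_val)
  refine h.denseRange hgu (Function.Surjective.denseRange fun x => ?_) hA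
  exact ⟨⟨⟨(z, x), fun _ => ⟨x, rfl⟩⟩, rfl⟩, coe_injective X (hg _)⟩

lemma not_completeSpace_rat : ¬ CompleteSpace (PUnit.{u + 1} → ℚ) := by
  intro _
  have hi : IsUniformInducing fun x : PUnit.{u + 1} → ℚ => ((x PUnit.unit : ℚ) : ℝ) := by
    refine Rat.isUniformEmbedding_coe_real.isUniformInducing.comp ⟨?_⟩
    rw [Pi.uniformity, iInf_unique]
  have hc := hi.isComplete_range.isClosed
  have hr : range (fun x : PUnit.{u + 1} → ℚ => ((x PUnit.unit : ℚ) : ℝ)) =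
      range ((↑) : ℚ → ℝ) :=
    Subset.antisymm (by rintro _ ⟨x, rfl⟩; exact ⟨_, rfl⟩)
      (by rintro _ ⟨q, rfl⟩; exact ⟨fun _ => q, rfl⟩)
  rw [hr] at hc
  have := hc.closure_eq.symm.trans Rat.denseRange_cast.closure_range
  exact irrational_sqrt_two (this ▸ mem_univ _)

/-- If `C` contains a space that is not compact, it contains one that is not complete: a complete
space that is not totally bounded has an infinite uniformly discrete subset, a countable part of
which maps onto the rational numbers. -/
lemma exists_not_completeSpace (h : ClosureProperties C) {X : T2Unif.{u}} (hX : C X)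
    (hXc : ¬ CompactSpace X.obj) : ∃ W : T2Unif.{u}, C W ∧ ¬ CompleteSpace W.obj := by
  by_cases hc : CompleteSpace X.obj
  · refine ⟨of (PUnit.{u + 1} → ℚ), ?_, not_completeSpace_rat⟩
    by_contra hC
    refine hXc ⟨isCompact_iff_totallyBounded_isComplete.2
      ⟨partitionFilter_aleph0_le_iff.1 fun V hV => ?_, completeSpace_iff_isComplete_univ.1 hc⟩⟩
    obtain ⟨ι, f, hι, hf⟩ := h.exists_discrete_partition hX hV
    refine ⟨ι, f, lt_of_not_ge fun hle => hC (h.of_discrete hι (le_trans ?_ hle)), hf⟩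
    exact mk_le_aleph0
  · exact ⟨X, hX, hc⟩

/-! ### The classification -/

lemma of_compactSpace (h : ClosureProperties C) {X : T2Unif.{u}} (hX : C X) [Nontrivial X.obj]
    {K : Type u} [UniformSpace K] [T2Space K] [CompactSpace K] : C (of K) := by
  refine h.of_partitionFilter_le le_rfl (fun ι hι => ?_)
    (partitionFilter_aleph0_le_iff.2 isCompact_univ.totallyBounded) uniformContinuous_id
    denseRange_id
  have := lt_aleph0_iff_finite.1 hι
  exact h.of_finite hX ι

theorem isOfFourKinds (h : ClosureProperties C) : IsOfFourKinds C := by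
  by_cases h1 : ∀ X, C X → Subsingleton X.obj
  · refine Or.inl (funext fun X => propext ⟨h1 X, fun hX => ?_⟩)
    have : Subsingleton X.obj := hX
    exact h.of_subsingleton
  push Not at h1
  obtain ⟨X₀, hX₀, _⟩ := h1
  by_cases h2 : ∀ X, C X → CompactSpace X.obj
  · refine Or.inr (Or.inl (funext fun X => propext ⟨h2 X, fun hX => ?_⟩))
    have : CompactSpace X.obj := hX
    exact h.of_compactSpace hX₀
  push Not at h2
  obtain ⟨Z, hZ, hZc⟩ := h2
  obtain ⟨W, hW, hWc⟩ := h.exists_not_completeSpace hZ hZc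
  by_cases h3 : ∀ ι : Type u, C (discrete ι)
  · exact Or.inr (Or.inr (Or.inr (funext fun X => propext
      ⟨fun _ => trivial, fun _ => h.of_discrete (h3 X.obj) le_rfl⟩)))
  -- Otherwise the bound is the least cardinality of a discrete space outside `C`.
  push Not at h3
  obtain ⟨ι₀, hι₀, hmin⟩ : ∃ ι₀ : Type u, ¬ C (discrete ι₀) ∧
      ∀ ι : Type u, #ι < #ι₀ → C (discrete ι) := by
    obtain ⟨ι₀, hι₀, hm⟩ := (InvImage.wf Cardinal.mk Cardinal.lt_wf).has_min
      {ι : Type u | ¬ C (discrete ι)} h3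
    exact ⟨ι₀, hι₀, fun ι hι => by_contra fun hC => hm ι hC hι⟩
  have hl : ℵ₀ ≤ #ι₀ := by
    refine le_of_not_gt fun hlt => hι₀ ?_
    have := lt_aleph0_iff_finite.1 hlt
    exact h.of_finite hX₀ ι₀
  refine Or.inr (Or.inr (Or.inl ⟨#ι₀, hl, funext fun X => propext ⟨fun hX => ?_, fun hX => ?_⟩⟩))
  · refine (coveringCharacter_le_iff hl).2 fun V hV => ?_
    obtain ⟨ι, f, hι, hf⟩ := h.exists_discrete_partition hX hV
    let _ : UniformSpace ι₀ := ⊥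
    exact ⟨ι, f, lt_of_not_ge fun hle => hι₀ (h.of_discrete hι hle), hf⟩
  · exact h.of_completion hW hWc (h.of_partitionFilter_le hl hmin
      ((coveringCharacter_le_iff hl).1 hX) (UniformSpace.Completion.uniformContinuous_coe X.obj)
      UniformSpace.Completion.denseRange_coe)

end ClosureProperties

/-! ### Independence of the four closure properties -/

lemma isClosedUnderIsomorphisms_of
    (h : ∀ {α β : Type u} [UniformSpace α] [T2Space α] [UniformSpace β] [T2Space β]
      {f : α → β}, UniformContinuous f → Function.Bijective f → C (of α) → C (of β)) :
    C.IsClosedUnderIsomorphisms :=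
  ⟨fun e hX => h (uniformContinuous_fn e.hom) ⟨(mono_iff e.hom).1 inferInstance, fun y =>
    ⟨fn e.inv y, congrArg (fun k => fn k y) e.inv_hom_id⟩⟩ hX⟩

/-- Apart from the two smallest ones, the four kinds contain all totally bounded spaces. -/
lemma IsOfFourKinds.cases (h : IsOfFourKinds C) : C = atMostOnePoint ∨ C = compactSpaces ∨
    ∀ (α : Type u) [UniformSpace α] [T2Space α], TotallyBounded (univ : Set α) → C (of α) := by
  rcases h with h | h | ⟨l, hl, rfl⟩ | rfl
  · exact Or.inl h
  · exact Or.inr (Or.inl h)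
  · exact Or.inr (Or.inr fun α _ _ hα => ((coveringCharacter_le_iff le_rfl).2
      (partitionFilter_aleph0_le_iff.2 hα)).trans hl)
  · exact Or.inr (Or.inr fun _ _ _ _ => trivial)

/-- A subcategory of one of the four kinds with a member that has two points contains all compact
spaces. -/
lemma IsOfFourKinds.of_compactSpace (h : IsOfFourKinds C) {X : T2Unif.{u}} (hX : C X)
    [Nontrivial X.obj] (K : Type u) [UniformSpace K] [T2Space K] [CompactSpace K] : C (of K) :=
  h.closureProperties.of_compactSpace hX

instance : Nontrivial (of (PUnit.{u + 1} → Bool)).obj :=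
  inferInstanceAs (Nontrivial (PUnit → Bool))

/-- The spaces with at most two points satisfy all closure properties except for that under
products. -/
lemma exists_not_isClosedUnderProducts :
    ∃ C : ObjectProperty T2Unif.{u}, C.IsClosedUnderIsomorphisms ∧
      C.InheritedFromTarget (MorphismProperty.extremalMonos T2Unif.{u}) ∧
      C.InheritedFromSource (MorphismProperty.bimorphisms T2Unif.{u}) ∧
      C.InheritedFromSource (MorphismProperty.extremalEpis T2Unif.{u}) ∧
      ¬ IsOfFourKinds C := by
  let C : ObjectProperty T2Unif.{u} := fun X => #X.obj ≤ 2
  have hsurj {α β : Type u} [UniformSpace α] [T2Space α] [UniformSpace β] [T2Space β] {f : α → β}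
      (hd : DenseRange f) (h : C (of α)) : C (of β) := by
    have hlt : #α < ℵ₀ := lt_of_le_of_lt h (natCast_lt_aleph0 (n := 2))
    have : Finite α := lt_aleph0_iff_finite.1 hlt
    have hs : Function.Surjective f := by
      rw [← range_eq_univ, ← hd.closure_range, (finite_range f).isClosed.closure_eq]
    exact (mk_le_of_surjective hs).trans h
  have hiso : C.IsClosedUnderIsomorphisms :=
    isClosedUnderIsomorphisms_of fun _ hf => hsurj hf.surjective.denseRange
  refine ⟨C, hiso, inheritedFromTarget_extremalMonos_iff.2 fun {_ _ _ s} _ h =>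
      (mk_set_le s).trans h,
    inheritedFromSource_bimorphisms_of fun _ hd _ => hsurj hd,
    inheritedFromSource_extremalEpis_of fun _ hs => hsurj hs.denseRange, fun hC => ?_⟩
  have h2 : C (of (PUnit.{u + 1} → Bool)) := by simp [C]
  have h3 : C (of (PUnit.{u + 1} → Fin 2 → Bool)) := hC.of_compactSpace h2 _
  have : (4 : Cardinal.{u}) ≤ 2 := by simpa [C] using h3
  exact absurd this (by norm_num)

/-- The connected spaces, the empty space included, satisfy all closure properties except for that
under extremal subobjects. -/
lemma exists_not_inheritedFromTarget_extremalMonos :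
    ∃ C : ObjectProperty T2Unif.{u}, C.IsClosedUnderIsomorphisms ∧
      C.IsClosedUnderProducts ∧
      C.InheritedFromSource (MorphismProperty.bimorphisms T2Unif.{u}) ∧
      C.InheritedFromSource (MorphismProperty.extremalEpis T2Unif.{u}) ∧
      ¬ IsOfFourKinds C := by
  let C : ObjectProperty T2Unif.{u} := fun X => PreconnectedSpace X.obj
  have hd {α β : Type u} [UniformSpace α] [T2Space α] [UniformSpace β] [T2Space β] {f : α → β}
      (hf : UniformContinuous f) (hd : DenseRange f) (h : C (of α)) : C (of β) := by
    have : PreconnectedSpace α := h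
    exact hd.preconnectedSpace hf.continuous
  have hiso : C.IsClosedUnderIsomorphisms :=
    isClosedUnderIsomorphisms_of fun hu hf => hd hu hf.surjective.denseRange
  refine ⟨C, hiso, isClosedUnderProducts_iff.2 fun α _ _ h => ?_,
    inheritedFromSource_bimorphisms_of fun hu h _ => hd hu h,
    inheritedFromSource_extremalEpis_of fun hu hs => hd hu hs.denseRange, fun hC => ?_⟩
  · have : ∀ j, PreconnectedSpace (α j) := h
    exact inferInstanceAs (PreconnectedSpace (∀ j, α j))
  · have hI : C (of (PUnit.{u + 1} → ℝ)) := inferInstanceAs (PreconnectedSpace (PUnit → ℝ))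
    have : Nontrivial (of (PUnit.{u + 1} → ℝ)).obj := inferInstanceAs (Nontrivial (PUnit → ℝ))
    have hB : PreconnectedSpace (PUnit.{u + 1} → Bool) := hC.of_compactSpace hI _
    exact not_subsingleton (PUnit.{u + 1} → Bool) PreconnectedSpace.trivial_of_discrete

/-- The points of finite support are dense in a power of the two-point space. -/
lemma dense_of_finite_support {ι : Type u} {s : Set (ι → Bool)}
    (hs : ∀ f : ι → Bool, {i | f i = true}.Finite → f ∈ s) : Dense s := by
  classical
  intro f
  refine mem_closure_of_tendsto
    (f := fun F : Finset ι => F.piecewise f fun _ => false) (b := Filter.atTop)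
    (tendsto_pi_nhds.2 fun i => tendsto_const_nhds.congr' ?_)
    (Filter.Eventually.of_forall fun F => hs _ (F.finite_toSet.subset fun i hi => ?_))
  · filter_upwards [Filter.eventually_ge_atTop {i}] with F hF
    simp [Finset.singleton_subset_iff.1 hF]
  · by_contra h
    simp_all

/-- A proper subset of a power of the two-point space with all points of finite support is not
compact. -/
lemma not_isCompact_of_finite_support {ι : Type u} {s : Set (ι → Bool)}
    (hs : ∀ f : ι → Bool, {i | f i = true}.Finite → f ∈ s) (h1 : (fun _ => true) ∉ s) :
    ¬ IsCompact s := fun hc =>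
  h1 (by rw [← hc.isClosed.closure_eq, (dense_of_finite_support hs).closure_eq]; trivial)

/-- The spaces in which each countable set is contained in a compact set satisfy all closure
properties except for that under bimorphic images. A `Σ`-product of two-point spaces is a member
that is not compact, and a countable totally bounded space that is not compact is not a member. -/
lemma exists_not_inheritedFromSource_bimorphisms :
    ∃ C : ObjectProperty T2Unif.{u}, C.IsClosedUnderIsomorphisms ∧
      C.IsClosedUnderProducts ∧
      C.InheritedFromTarget (MorphismProperty.extremalMonos T2Unif.{u}) ∧
      C.InheritedFromSource (MorphismProperty.extremalEpis T2Unif.{u}) ∧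
      ¬ IsOfFourKinds C := by
  let C : ObjectProperty T2Unif.{u} := fun X =>
    ∀ s : Set X.obj, s.Countable → ∃ K, IsCompact K ∧ s ⊆ K
  have hsurj {α β : Type u} [UniformSpace α] [T2Space α] [UniformSpace β] [T2Space β] {f : α → β}
      (hf : UniformContinuous f) (hs : Function.Surjective f) (h : C (of α)) : C (of β) := by
    intro s hsc
    obtain ⟨K, hK, hsK⟩ := h (Function.surjInv hs '' s) (hsc.image _)
    exact ⟨f '' K, hK.image hf.continuous, fun y hy =>
      ⟨_, hsK (mem_image_of_mem _ hy), Function.surjInv_eq hs y⟩⟩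
  have hiso : C.IsClosedUnderIsomorphisms :=
    isClosedUnderIsomorphisms_of fun hu hf => hsurj hu hf.surjective
  refine ⟨C, hiso, isClosedUnderProducts_iff.2 fun α _ _ h s hs => ?_,
    inheritedFromTarget_extremalMonos_iff.2 fun {α _ _ t} ht h s hs => ?_,
    inheritedFromSource_extremalEpis_of hsurj, fun hC => ?_⟩
  · choose K hK hsK using fun j => h j ((fun x => x j) '' s) (hs.image _)
    exact ⟨univ.pi K, isCompact_univ_pi hK, fun x hx j _ => hsK j (mem_image_of_mem _ hx)⟩
  · obtain ⟨K, hK, hsK⟩ := h (Subtype.val '' s) (hs.image _)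
    exact ⟨Subtype.val ⁻¹' K, ht.isClosedEmbedding_subtypeVal.isCompact_preimage hK,
      image_subset_iff.1 hsK⟩
  · rcases hC.cases with h | h | h
    · have h2 : C (of (PUnit.{u + 1} → Bool)) := fun s _ =>
        ⟨univ, (isCompact_univ : IsCompact (univ : Set (PUnit.{u + 1} → Bool))), subset_univ s⟩
      rw [h] at h2
      exact not_subsingleton (PUnit.{u + 1} → Bool) h2
    · let ι := ULift.{u} ℝ
      let S : Set (ι → Bool) := {f | {i | f i = true}.Countable}
      have hS : C (of S) := by
        intro s hs
        let A : Set ι := ⋃ f ∈ s, {i | f.1 i = true}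
        have hA : A.Countable := hs.biUnion fun f _ => f.2
        let K : Set (ι → Bool) := {f | ∀ i, i ∉ A → f i = false}
        have hK : IsClosed K := by
          simp only [K, ofPred_forall]
          exact isClosed_iInter fun i => isClosed_iInter fun _ =>
            isClosed_eq (continuous_apply i) continuous_const
        have hKS : K ⊆ S := fun f hf => hA.mono fun i hi => by
          by_contra hiA
          simp_all [hf i hiA]
        refine ⟨Subtype.val ⁻¹' K, ?_, fun f hf i hi => ?_⟩
        · rw [Topology.IsInducing.subtypeVal.isCompact_iff, Subtype.image_preimage_coe,
            inter_eq_right.2 hKS]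
          exact hK.isCompact
        · simpa using fun hfi => hi (mem_biUnion hf hfi)
      rw [h] at hS
      refine not_isCompact_of_finite_support (s := S) (fun f hf => hf.countable) ?_
        (isCompact_iff_compactSpace.2 hS)
      simp only [S, mem_ofPred_eq, ofPred_true, countable_univ_iff]
      exact not_countable
    · let ι := ULift.{u} ℕ
      let S : Set (ι → Bool) := {f | {i | f i = true}.Finite}
      have hS : S.Countable := by
        have hinj : Function.Injective fun f : ι → Bool => {i | f i = true} := fun f g hfg =>
          funext fun i => Bool.eq_iff_iff.2 (Set.ext_iff.1 hfg i)
        refine Set.Countable.mono ?_ ((countable_ofPred_finite_subset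
          (countable_univ (α := ι))).preimage_of_injOn hinj.injOn)
        intro f hf
        exact mem_preimage.2 ⟨hf, subset_univ _⟩
      have := hS.to_subtype
      obtain ⟨K, hK, hsK⟩ := h S (totallyBounded_preimage
        isUniformEmbedding_subtype_val.isUniformInducing
        isCompact_univ.totallyBounded) Set.univ (countable_univ (α := S))
      obtain rfl : K = Set.univ := univ_subset_iff.1 hsK
      refine not_isCompact_of_finite_support (s := S) (fun f hf => hf) ?_
        (isCompact_iff_isCompact_univ.2 hK)
      simp only [S, mem_ofPred_eq, ofPred_true]
      exact infinite_univ

/-- The compact totally disconnected spaces satisfy all closure properties except for that under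
extremal epi images. -/
lemma exists_not_inheritedFromSource_extremalEpis :
    ∃ C : ObjectProperty T2Unif.{u}, C.IsClosedUnderIsomorphisms ∧
      C.IsClosedUnderProducts ∧
      C.InheritedFromTarget (MorphismProperty.extremalMonos T2Unif.{u}) ∧
      C.InheritedFromSource (MorphismProperty.bimorphisms T2Unif.{u}) ∧
      ¬ IsOfFourKinds C := by
  let C : ObjectProperty T2Unif.{u} := fun X => CompactSpace X.obj ∧ TotallyDisconnectedSpace X.obj
  have hinj {α β : Type u} [UniformSpace α] [T2Space α] [UniformSpace β] [T2Space β] {f : α → β}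
      (hf : UniformContinuous f) (hd : DenseRange f) (hi : Function.Injective f)
      (h : C (of α)) : C (of β) := by
    have : CompactSpace α := h.1
    have : TotallyDisconnectedSpace α := h.2
    have he := hf.continuous.isClosedEmbedding hi
    have hs : Function.Surjective f := by
      rw [← range_eq_univ, ← hd.closure_range, he.isClosed_range.closure_eq]
    let e : α ≃ₜ β := he.isEmbedding.toHomeomorphOfSurjective hs
    exact ⟨e.compactSpace, e.totallyDisconnectedSpace⟩
  have hiso : C.IsClosedUnderIsomorphisms :=
    isClosedUnderIsomorphisms_of fun hu hf => hinj hu hf.surjective.denseRange hf.injective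
  refine ⟨C, hiso, isClosedUnderProducts_iff.2 fun α _ _ h => ?_,
    inheritedFromTarget_extremalMonos_iff.2 fun {α _ _ t} ht h => ?_,
    inheritedFromSource_bimorphisms_of hinj, fun hC => ?_⟩
  · have h1 (j) : CompactSpace (α j) := (h j).1
    have h2 (j) : TotallyDisconnectedSpace (α j) := (h j).2
    exact ⟨inferInstanceAs (CompactSpace (∀ j, α j)),
      inferInstanceAs (TotallyDisconnectedSpace (∀ j, α j))⟩
  · have : CompactSpace α := h.1
    have : TotallyDisconnectedSpace α := h.2
    exact ⟨isCompact_iff_compactSpace.1 ht.isCompact,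
      inferInstanceAs (TotallyDisconnectedSpace t)⟩
  · have h2 : C (of (PUnit.{u + 1} → Bool)) :=
      ⟨inferInstanceAs (CompactSpace (PUnit → Bool)),
        inferInstanceAs (TotallyDisconnectedSpace (PUnit → Bool))⟩
    have hI : TotallyDisconnectedSpace (PUnit.{u + 1} → unitInterval) :=
      (hC.of_compactSpace h2 (PUnit.{u + 1} → unitInterval)).2
    have := subsingleton_univ_iff.1
      (hI.isTotallyDisconnected_univ univ subset_rfl isPreconnected_univ)
    exact not_subsingleton (PUnit.{u + 1} → unitInterval) this

end T2Unif

theorem theorem2 :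
    -- the characterization of the epireflective subcategories closed under epi images
    (∀ C : ObjectProperty T2Unif.{u}, C.IsClosedUnderIsomorphisms →
      ((C.IsEpireflective ∧ C.InheritedFromSource (MorphismProperty.epimorphisms T2Unif.{u})) ↔
        T2Unif.IsOfFourKinds C)) ∧
    -- the first condition, written as four closure properties
    (∀ C : ObjectProperty T2Unif.{u}, C.IsClosedUnderIsomorphisms →
      ((C.IsEpireflective ∧ C.InheritedFromSource (MorphismProperty.epimorphisms T2Unif.{u})) ↔
        (C.IsClosedUnderProducts ∧
          C.InheritedFromTarget (MorphismProperty.extremalMonos T2Unif.{u}) ∧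
          C.InheritedFromSource (MorphismProperty.bimorphisms T2Unif.{u}) ∧
          C.InheritedFromSource (MorphismProperty.extremalEpis T2Unif.{u})))) ∧
    -- closure under products cannot be omitted
    (∃ C : ObjectProperty T2Unif.{u}, C.IsClosedUnderIsomorphisms ∧
      C.InheritedFromTarget (MorphismProperty.extremalMonos T2Unif.{u}) ∧
      C.InheritedFromSource (MorphismProperty.bimorphisms T2Unif.{u}) ∧
      C.InheritedFromSource (MorphismProperty.extremalEpis T2Unif.{u}) ∧
      ¬ T2Unif.IsOfFourKinds C) ∧
    -- closure under extremal subobjects cannot be omitted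
    (∃ C : ObjectProperty T2Unif.{u}, C.IsClosedUnderIsomorphisms ∧
      C.IsClosedUnderProducts ∧
      C.InheritedFromSource (MorphismProperty.bimorphisms T2Unif.{u}) ∧
      C.InheritedFromSource (MorphismProperty.extremalEpis T2Unif.{u}) ∧
      ¬ T2Unif.IsOfFourKinds C) ∧
    -- closure under bimorphic images cannot be omitted
    (∃ C : ObjectProperty T2Unif.{u}, C.IsClosedUnderIsomorphisms ∧
      C.IsClosedUnderProducts ∧
      C.InheritedFromTarget (MorphismProperty.extremalMonos T2Unif.{u}) ∧
      C.InheritedFromSource (MorphismProperty.extremalEpis T2Unif.{u}) ∧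
      ¬ T2Unif.IsOfFourKinds C) ∧
    -- closure under extremal epi images cannot be omitted
    (∃ C : ObjectProperty T2Unif.{u}, C.IsClosedUnderIsomorphisms ∧
      C.IsClosedUnderProducts ∧
      C.InheritedFromTarget (MorphismProperty.extremalMonos T2Unif.{u}) ∧
      C.InheritedFromSource (MorphismProperty.bimorphisms T2Unif.{u}) ∧
      ¬ T2Unif.IsOfFourKinds C) := by
  refine ⟨fun C _ => ?_, fun C _ => ?_, T2Unif.exists_not_isClosedUnderProducts,
    T2Unif.exists_not_inheritedFromTarget_extremalMonos,
    T2Unif.exists_not_inheritedFromSource_bimorphisms,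
    T2Unif.exists_not_inheritedFromSource_extremalEpis⟩
  · rw [T2Unif.isEpireflective_and_inheritedFromSource_iff]
    exact ⟨fun h => h.isOfFourKinds, fun h => h.closureProperties⟩
  · rw [T2Unif.isEpireflective_and_inheritedFromSource_iff, T2Unif.closureProperties_iff]
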